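/- Let $a,b,c$ be real numbers with $0<a<b<c$, put $m=\lfloor c/b\rfloor$ and $c_0=c-mb$, and assume that $b-a<c_0<a$, $m\ge 2$ and $a/b\notin\mathbb{Q}$. Let $\mathcal{S}_{a,b,c}$ be the set of all $t\in\mathbb{R}$ for which there is a binary vector $\mathbf{x}=(\mathbf{x}(\lambda))_{\lambda\in b\mathbb{Z}}\in\{0,1\}^{b\mathbb{Z}}$ with $\mathbf{x}(0)=1$ and $$\sum_{\lambda\in b\mathbb{Z}}\chi_{[0,c)}(t-\mu+\lambda)\,\mathbf{x}(\lambda)=1\quad\text{for all }\mu\in a\mathbb{Z}.$$ Define piecewise linear transformations $R,\tilde R:\mathbb{R}\to\mathbb{R}$ by $$R(t)=\begin{cases} t+mb+b & t\in[0,c_0+a-b)+a\mathbb{Z},\\ t & t\in[c_0+a-b,c_0)+a\mathbb{Z},\\ t+mb & t\in[c_0,a)+a\mathbb{Z},\end{cases}\qquad \tilde R(t)=\begin{cases} t-mb & t\in[c-a,c-c_0)+a\mathbb{Z},\\ t & t\in[c-c_0,c-c_0+b-a)+a\mathbb{Z},\\ t-mb-b & t\in[c-c_0+b-a,c)+a\mathbb{Z},\end{cases}$$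 and call $H=[c_0+a-b,c_0)+a\mathbb{Z}$ and $\tilde H=[c-c_0,c-c_0+b-a)+a\mathbb{Z}$ the black holes of $R$ and $\tilde R$, respectively. Suppose that $\mathcal{S}_{a,b,c}\neq\emptyset$. Then there is an integer $D$ with $0\le D\le\lfloor a/(b-a)\rfloor-1$ such that all of the following hold. 1. $\tilde R^{\,n}(c_0+a-b)+a\mathbb{Z}=R^{D-n}(c-c_0)+a\mathbb{Z}$ for all $0\le n\le D$. 2. The sets $R^n(c-c_0)+[0,b-a]+a\mathbb{Z}$, $0\le n\le D$, are mutually disjoint. 3. For all $0\le n\le D$, $R^n(\tilde H)=R^n(c-c_0)+[0,b-a)+a\mathbb{Z}$ (a periodic hole of length $b-a$) and $R^n(\tilde H)=\tilde R^{\,D-n}(H)$. In particular $R^D(\tilde H)=H$. 4. $$\mathbb{R}\setminus\mathcal{S}_{a,b,c}=\bigcup_{n=0}^{D}\bigl(R^n(c-c_0)+[0,b-a)+a\mathbb{Z}\bigr)=\bigcup_{n=0}^{D}R^n(\tilde H)=\bigcup_{n=0}^{D}\tilde R^{\,n}(H)=\bigcup_{n=0}^{D}\bigl(\tilde R^{\,n}(c_0+a-b)+[0,b-a)+a\mathbb{Z}\bigr).$$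 -/

import Mathlib

noncomputable section

namespace AbcGabor

/-- The set `E + rℤ`. -/
def periodize (r : ℝ) (E : Set ℝ) : Set ℝ :=
  {t | ∃ s ∈ E, ∃ k : ℤ, t = s + k * r}

/-- The infinite matrix `M_{a,b,c}(t) = (χ_{[0,c)}(t - μ + λ))` with rows `μ ∈ aℤ` and columns
`λ ∈ bℤ`; the row `μ = k a` is indexed by the integer `k` and the column `λ = l b` by the
integer `l`. -/
def infMatrix (a b c t : ℝ) : Matrix ℤ ℤ ℝ :=
  fun k l => Set.indicator (Set.Ico 0 c) (fun _ => (1 : ℝ)) (t - k * a + l * b)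

/-- The binary vectors indexed by `bℤ` (the entry at `λ = l b` is `x l`) whose entry at the origin
is one. -/
def binaryVectors₀ : Set (ℤ → ℝ) :=
  {x | (∀ l, x l = 0 ∨ x l = 1) ∧ x 0 = 1}

/-- The set `S_{a,b,c}` of all real `t` such that `M_{a,b,c}(t) x = 1` (the vector whose entries
are all one) for some binary vector `x` with `x 0 = 1`. -/
def invariantSet (a b c : ℝ) : Set ℝ :=
  {t | ∃ x ∈ binaryVectors₀, ∀ k : ℤ, HasSum (fun l : ℤ => infMatrix a b c t k l * x l) 1}

/-- `c₀ = c - ⌊c/b⌋ b`. -/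
def cZero (b c : ℝ) : ℝ := c - ⌊c / b⌋ * b

/-- The black hole `[c₀ + a - b, c₀) + aℤ` of `R_{a,b,c}`. -/
def blackHole (a b c : ℝ) : Set ℝ :=
  periodize a (Set.Ico (cZero b c + a - b) (cZero b c))

/-- The black hole `[c - c₀, c - c₀ + b - a) + aℤ` of the transformation `R̃_{a,b,c}`. -/
def blackHoleTilde (a b c : ℝ) : Set ℝ :=
  periodize a (Set.Ico (c - cZero b c) (c - cZero b c + b - a))

open Classical in
/-- The piecewise linear transformation `R_{a,b,c}`. For `b - a < c₀ < a` the last case is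
`t ∈ [c₀, a) + aℤ`. -/
def R (a b c t : ℝ) : ℝ :=
  if t ∈ periodize a (Set.Ico 0 (cZero b c + a - b)) then t + ⌊c / b⌋ * b + b
  else if t ∈ blackHole a b c then t
  else t + ⌊c / b⌋ * b

open Classical in
/-- The piecewise linear transformation `R̃_{a,b,c}`. For `b - a < c₀ < a` the last case is
`t ∈ [c + b - c₀ - a, c) + aℤ`. -/
def RTilde (a b c t : ℝ) : ℝ :=
  if t ∈ periodize a (Set.Ico (c - a) (c - cZero b c)) then t - ⌊c / b⌋ * b
  else if t ∈ blackHoleTilde a b c then t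
  else t - ⌊c / b⌋ * b - b

end AbcGabor

end

/-! Write S for the invariant set and m for `⌊c / b⌋`. For t in S, the adjacent window forces the
next selected column to be m or m + 1 steps away (`exists_succ`, `exists_pred`); so `R` maps S onto
S, `RTilde` undoes it there, and both black holes miss S.

Adding `a` on one branch of `R` gives a lift that is increasing on S, with displacement m b + a or m
b + b. Hence `R` preserves the length of the gap of S to the left of a point v in S, with two
exceptions: if v is the first point of S after c₀ + aℤ, the gap contains the black hole and may lose
up to b - a; if v is the first point after aℤ, the gap may grow (`leftGap_R`, `leftGap_R_of_add`,
`leftGap_of_R`).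

Each step of `R` on S is a positive multiple of b, so by irrationality no orbit in S repeats modulo
`a`, while a period holds only finitely many gaps of length at least ε. Every gap therefore runs
forward into the first point after c₀ and comes, after at least one step, from the first point after
0. A gap directly to the left of the first point after 0, or one surviving the black hole, would
make an orbit repeat. So 0 and c₀ lie in S, no gap ends at 0, and no gap exceeds b - a.

The black hole of `RTilde` is, modulo `a`, the gap ending at `R 0`. If `R 0` reaches c₀ after D
steps, the gaps of S are exactly those ending at the D + 1 intermediate points. Each has length b -
a, and fitting them disjointly into one period bounds D. -/

namespace AbcGabor

/-- The standing assumptions on `a, b, c`. -/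
structure Params (a b c : ℝ) : Prop where
  ha : 0 < a
  hab : a < b
  hbc : b < c
  lt_cZero : b - a < cZero b c
  cZero_lt : cZero b c < a
  two_le : 2 ≤ ⌊c / b⌋
  irr : Irrational (a / b)

/-! ### The linear system as a combinatorial covering condition -/

lemma eq_add_cZero (b c : ℝ) : c = ⌊c / b⌋ * b + cZero b c := by
  unfold cZero; ring

lemma hasSum_zero_one_iff {ι : Type*} {f : ι → ℝ} (hf : ∀ i, f i = 0 ∨ f i = 1) :
    HasSum f 1 ↔ ∃! i, f i = 1 := by
  classical
  have h0 : ∀ i, 0 ≤ f i := fun i => by rcases hf i with h | h <;> simp [h]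
  constructor
  · intro h
    obtain ⟨i, hi⟩ : ∃ i, f i = 1 := by
      by_contra! hne
      have : f = fun _ => 0 := funext fun i => (hf i).resolve_right (hne i)
      rw [this] at h
      exact zero_ne_one (hasSum_zero.unique h)
    refine ⟨i, hi, fun j hj => ?_⟩
    by_contra hij
    have := sum_le_hasSum {i, j} (fun k _ => h0 k) h
    rw [Finset.sum_pair (Ne.symm hij), hi, show f j = 1 from hj] at this
    norm_num at this
  · rintro ⟨i, hi, hu⟩
    rw [← hi]
    exact hasSum_single i fun j hj => (hf j).resolve_right fun h => hj (hu j h)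

/-- The integers `l` selected by a binary vector meet every window exactly once. -/
def HitsOnce (a b c t : ℝ) (A : Set ℤ) : Prop :=
  ∀ k : ℤ, ∃! l : ℤ, l ∈ A ∧ t - k * a + l * b ∈ Set.Ico 0 c

lemma mem_invariantSet_iff {a b c t : ℝ} :
    t ∈ invariantSet a b c ↔ ∃ A : Set ℤ, (0 : ℤ) ∈ A ∧ HitsOnce a b c t A := by
  classical
  have key : ∀ x : ℤ → ℝ, (∀ l, x l = 0 ∨ x l = 1) → ∀ k : ℤ,
      (HasSum (fun l : ℤ => infMatrix a b c t k l * x l) 1 ↔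
        ∃! l : ℤ, l ∈ {l | x l = 1} ∧ t - k * a + l * b ∈ Set.Ico 0 c) := by
    intro x hx k
    have hv : ∀ l, infMatrix a b c t k l * x l = 0 ∨ infMatrix a b c t k l * x l = 1 := by
      intro l
      unfold infMatrix
      by_cases h : t - k * a + l * b ∈ Set.Ico 0 c
      · rcases hx l with h1 | h1 <;> simp [h, h1]
      · simp [h]
    rw [hasSum_zero_one_iff hv]
    refine existsUnique_congr fun l => ?_
    unfold infMatrix
    by_cases h : t - k * a + l * b ∈ Set.Ico 0 c
    · simp only [Set.indicator_of_mem h, one_mul, Set.mem_ofPred_eq, h, and_true]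
    · simp only [Set.indicator_of_notMem h, zero_mul, h, and_false, zero_ne_one]
  constructor
  · rintro ⟨x, ⟨hx, hx0⟩, h⟩
    exact ⟨{l | x l = 1}, hx0, fun k => (key x hx k).1 (h k)⟩
  · rintro ⟨A, hA, h⟩
    have hx : ∀ l, A.indicator (fun _ => (1 : ℝ)) l = 0 ∨ A.indicator (fun _ => (1 : ℝ)) l = 1 := by
      intro l
      by_cases hl : l ∈ A <;> simp [hl]
    refine ⟨A.indicator fun _ => 1, ⟨hx, by simp [hA]⟩, fun k => (key _ hx k).2 ?_⟩
    have : {l | A.indicator (fun _ => (1 : ℝ)) l = 1} = A := by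
      ext l
      by_cases hl : l ∈ A <;> simp [hl]
    rw [this]
    exact h k

lemma add_int_mul_mem {a b c t : ℝ} (k : ℤ) (ht : t ∈ invariantSet a b c) :
    t + k * a ∈ invariantSet a b c := by
  rw [mem_invariantSet_iff] at ht ⊢
  obtain ⟨A, hA, h⟩ := ht
  refine ⟨A, hA, fun j => ?_⟩
  convert h (j - k) using 5
  push_cast; ring

lemma add_int_mul_mem_iff {a b c t : ℝ} (k : ℤ) :
    t + k * a ∈ invariantSet a b c ↔ t ∈ invariantSet a b c := by
  refine ⟨fun h => ?_, add_int_mul_mem k⟩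
  have := add_int_mul_mem (-k) h
  push_cast at this
  rwa [show t + k * a + -(k : ℝ) * a = t by ring] at this

/-- Any selected column may serve as the origin. -/
lemma HitsOnce.shift {a b c t : ℝ} {A : Set ℤ} (h : HitsOnce a b c t A) {l : ℤ} (hl : l ∈ A) :
    t + l * b ∈ invariantSet a b c := by
  rw [mem_invariantSet_iff]
  refine ⟨{j | j + l ∈ A}, by simpa using hl, fun k => ?_⟩
  obtain ⟨j, ⟨hj, hj'⟩, hu⟩ := h k
  refine ⟨j - l, ⟨by simpa using hj, ?_⟩, ?_⟩
  · convert hj' using 1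
    push_cast; ring
  · rintro i ⟨hi, hi'⟩
    have := hu (i + l) ⟨hi, by convert hi' using 1; push_cast; ring⟩
    omega

/-- Every real number lies in a period `[x + k a, x + k a + a)`. -/
lemma exists_period {a : ℝ} (ha : 0 < a) (t x : ℝ) :
    ∃ k : ℤ, x + k * a ≤ t ∧ t < x + k * a + a := by
  refine ⟨⌊(t - x) / a⌋, ?_, ?_⟩
  · have := (le_div_iff₀ ha).1 (Int.floor_le ((t - x) / a))
    linarith
  · have := (div_lt_iff₀ ha).1 (Int.lt_floor_add_one ((t - x) / a))
    linarith

lemma int_mul_add_le {a : ℝ} (ha : 0 < a) {j k : ℤ} (h : j < k) : (j : ℝ) * a + a ≤ k * a := by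
  have : (j : ℝ) + 1 ≤ k := by exact_mod_cast h
  nlinarith

lemma int_eq_of_mem_period {a x t : ℝ} (ha : 0 < a) {j k : ℤ} (h1 : x + j * a ≤ t)
    (h2 : t < x + j * a + a) (h3 : x + k * a ≤ t) (h4 : t < x + k * a + a) : j = k := by
  rcases lt_trichotomy j k with h | h | h
  · have := int_mul_add_le ha h; linarith
  · exact h
  · have := int_mul_add_le ha h; linarith

/-! ### Next and previous selected columns -/

namespace Params

variable {a b c : ℝ}

lemma hc (_p : Params a b c) : c = ⌊c / b⌋ * b + cZero b c := eq_add_cZero b c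

lemma hb (p : Params a b c) : 0 < b := p.ha.trans p.hab

lemma floor_mul_pos (p : Params a b c) : b < ⌊c / b⌋ * b := by
  have h : (2 : ℝ) ≤ ⌊c / b⌋ := by exact_mod_cast p.two_le
  nlinarith [p.hb]

lemma cZero_pos (p : Params a b c) : 0 < cZero b c := by linarith [p.lt_cZero, p.hab]

lemma exists_succ (p : Params a b c) {t : ℝ} (ht : t ∈ invariantSet a b c) {k : ℤ}
    (h0 : k * a ≤ t) (h1 : t < k * a + a) :
    (t < k * a + (cZero b c + a - b) ∧ t + ⌊c / b⌋ * b + b ∈ invariantSet a b c) ∨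
      (k * a + cZero b c ≤ t ∧ t + ⌊c / b⌋ * b ∈ invariantSet a b c) := by
  obtain ⟨A, hA, h⟩ := mem_invariantSet_iff.1 ht
  have := p.ha; have := p.hab; have := p.hbc; have := p.cZero_lt; have := p.lt_cZero
  have hc := p.hc; have hm := p.floor_mul_pos
  obtain ⟨l, ⟨hl, hl0, hl1⟩, -⟩ := h (k + 1)
  push_cast at hl0 hl1
  obtain ⟨l', -, hu⟩ := h k
  have h0' : 0 = l' := hu 0 ⟨hA, by push_cast; constructor <;> linarith⟩
  -- Window k is already used by column 0, and column 0 has left window k + 1; so the column l used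
  -- there lies beyond window k, which leaves only two values for l.
  have hl2 : c ≤ t - k * a + l * b := by
    by_contra! hlt
    have : l = l' := hu l ⟨hl, by linarith, hlt⟩
    rw [← h0'] at this
    rw [this] at hl0
    push_cast at hl0
    linarith
  have hlm : ⌊c / b⌋ ≤ l := by
    by_contra! hlt
    have := int_mul_add_le p.hb hlt
    linarith
  have hlm' : l ≤ ⌊c / b⌋ + 1 := by
    by_contra! hlt
    have := int_mul_add_le p.hb hlt
    push_cast at this
    linarith
  have hmem := h.shift hl
  obtain rfl | rfl : l = ⌊c / b⌋ ∨ l = ⌊c / b⌋ + 1 := by omega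
  · right
    exact ⟨by linarith, hmem⟩
  · left
    push_cast at *
    exact ⟨by linarith, by convert hmem using 1; ring⟩

lemma exists_pred (p : Params a b c) {t : ℝ} (ht : t ∈ invariantSet a b c) {k : ℤ}
    (h0 : c - a + k * a ≤ t) (h1 : t < c - a + k * a + a) :
    (t < c - cZero b c + k * a ∧ t - ⌊c / b⌋ * b ∈ invariantSet a b c) ∨
      (c - cZero b c + (b - a) + k * a ≤ t ∧ t - ⌊c / b⌋ * b - b ∈ invariantSet a b c) := by
  obtain ⟨A, hA, h⟩ := mem_invariantSet_iff.1 ht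
  have := p.ha; have := p.hab; have := p.hbc; have := p.cZero_lt; have := p.lt_cZero
  have hc := p.hc; have hm := p.floor_mul_pos
  obtain ⟨l, ⟨hl, hl0, hl1⟩, -⟩ := h (k - 1)
  push_cast at hl0 hl1
  obtain ⟨l', -, hu⟩ := h k
  have h0' : 0 = l' := hu 0 ⟨hA, by push_cast; constructor <;> linarith⟩
  have hl2 : t - k * a + l * b < 0 := by
    by_contra! hlt
    have : l = l' := hu l ⟨hl, hlt, by linarith⟩
    rw [← h0'] at this
    rw [this] at hl1
    push_cast at hl1
    linarith
  have hlm : l ≤ -⌊c / b⌋ := by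
    by_contra! hlt
    have := int_mul_add_le p.hb hlt
    push_cast at this
    linarith
  have hlm' : -⌊c / b⌋ - 1 ≤ l := by
    by_contra! hlt
    have := int_mul_add_le p.hb hlt
    push_cast at this
    linarith
  have hmem := h.shift hl
  obtain rfl | rfl : l = -⌊c / b⌋ ∨ l = -⌊c / b⌋ - 1 := by omega
  · left
    push_cast at *
    exact ⟨by linarith, by convert hmem using 1; ring⟩
  · right
    push_cast at *
    exact ⟨by linarith, by convert hmem using 1; ring⟩

end Params

/-- The invariant set is closed under limits from the right. -/
lemma mem_invariantSet_of_forall_exists {a b c v : ℝ} (hb : 0 < b)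
    (hv : ∀ ε > 0, ∃ s ∈ invariantSet a b c, v ≤ s ∧ s < v + ε) :
    v ∈ invariantSet a b c := by
  classical
  set S := invariantSet a b c
  have hX : ∀ t : ℝ, ∃ A : Set ℤ, t ∈ S → (0 : ℤ) ∈ A ∧ HitsOnce a b c t A := fun t => by
    by_cases ht : t ∈ S
    · obtain ⟨A, hA⟩ := mem_invariantSet_iff.1 ht
      exact ⟨A, fun _ => hA⟩
    · exact ⟨∅, fun h => absurd h ht⟩
  choose X hX using hX
  have hne : (nhdsWithin v (Set.Ici v ∩ S)).NeBot := by
    rw [← mem_closure_iff_nhdsWithin_neBot, Metric.mem_closure_iff]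
    intro ε hε
    obtain ⟨s, hs, h1, h2⟩ := hv ε hε
    refine ⟨s, ⟨h1, hs⟩, ?_⟩
    rw [Real.dist_eq, abs_lt]
    constructor <;> linarith
  -- A limit of the selections `X t` as t decreases to v is taken along an ultrafilter. The windows
  -- are closed on the left and open on the right, so membership in each is eventually constant from
  -- the right.
  set 𝒰 : Ultrafilter ℝ := Ultrafilter.of (nhdsWithin v (Set.Ici v ∩ S))
  have hle : (𝒰 : Filter ℝ) ≤ nhdsWithin v (Set.Ici v ∩ S) := Ultrafilter.of_le _
  have hS : ∀ᶠ t in (𝒰 : Filter ℝ), v ≤ t ∧ t ∈ S := hle self_mem_nhdsWithin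
  have hlt : ∀ w, v < w → ∀ᶠ t in (𝒰 : Filter ℝ), t < w := fun w hw =>
    hle (mem_nhdsWithin_of_mem_nhds (Iio_mem_nhds hw))
  have hwin : ∀ (k l : ℤ), ∀ᶠ t in (𝒰 : Filter ℝ),
      (t - k * a + l * b ∈ Set.Ico 0 c ↔ v - k * a + l * b ∈ Set.Ico 0 c) := by
    intro k l
    by_cases h1 : v - k * a + l * b < 0
    · filter_upwards [hlt (k * a - l * b) (by linarith)] with t ht
      exact ⟨fun h => absurd h.1 (by linarith), fun h => absurd h.1 (by linarith)⟩
    · by_cases h2 : v - k * a + l * b < c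
      · filter_upwards [hS, hlt (c + k * a - l * b) (by linarith)] with t ht ht'
        exact ⟨fun _ => ⟨by linarith, h2⟩, fun _ => ⟨by linarith [ht.1], by linarith⟩⟩
      · filter_upwards [hS] with t ht
        exact ⟨fun h => absurd h.2 (by linarith [ht.1]), fun h => absurd h.2 h2⟩
  rw [mem_invariantSet_iff]
  refine ⟨{l | ∀ᶠ t in (𝒰 : Filter ℝ), l ∈ X t}, ?_, fun k => ?_⟩
  · filter_upwards [hS] with t ht using (hX t ht.2).1
  -- Only finitely many columns can meet window k for t near v, so the ultrafilter settles on one of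
  -- them.
  · have hfin : ∀ᶠ t in (𝒰 : Filter ℝ),
        ∃ l ∈ Set.Icc ⌊(-1 - v + k * a) / b⌋ ⌈(c - v + k * a) / b⌉,
          l ∈ X t ∧ t - k * a + l * b ∈ Set.Ico 0 c := by
      filter_upwards [hS, hlt (v + 1) (by linarith)] with t ht ht'
      obtain ⟨l, ⟨hl, hl'⟩, -⟩ := (hX t ht.2).2 k
      refine ⟨l, ⟨?_, ?_⟩, hl, hl'⟩
      · have h1 : (-1 - v + k * a) / b ≤ l := by
          rw [div_le_iff₀ hb]; linarith [hl'.1]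
        exact_mod_cast (Int.floor_le _).trans h1
      · have h1 : (l : ℝ) ≤ (c - v + k * a) / b := by
          rw [le_div_iff₀ hb]; linarith [hl'.2, ht.1]
        exact_mod_cast h1.trans (Int.le_ceil _)
    rw [Ultrafilter.eventually_exists_mem_iff (Set.finite_Icc _ _)] at hfin
    obtain ⟨l, -, hl⟩ := hfin
    have hl0 : v - k * a + l * b ∈ Set.Ico 0 c := by
      obtain ⟨t, h1, h2⟩ := (hl.and (hwin k l)).exists
      exact h2.1 h1.2
    refine ⟨l, ⟨hl.mono fun t ht => ht.1, hl0⟩, ?_⟩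
    rintro j ⟨hj, hj'⟩
    obtain ⟨t, ⟨⟨⟨h1, h2⟩, h3⟩, h4⟩, h5⟩ :=
      ((((hl.and hj).and (hwin k j)).and hS)).and (hwin k l) |>.exists
    exact ((hX t h4.2).2 k).unique ⟨h2, h3.2 hj'⟩ h1

end AbcGabor

/-! ### Periodic sets, gaps and first points -/

namespace AbcGabor

lemma mem_periodize_Ico {r x y t : ℝ} :
    t ∈ periodize r (Set.Ico x y) ↔ ∃ k : ℤ, x + k * r ≤ t ∧ t < y + k * r := by
  constructor
  · rintro ⟨s, ⟨h1, h2⟩, k, rfl⟩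
    exact ⟨k, by linarith, by linarith⟩
  · rintro ⟨k, h1, h2⟩
    exact ⟨t - k * r, ⟨by linarith, by linarith⟩, k, by ring⟩

lemma mem_periodize_Icc {r x y t : ℝ} :
    t ∈ periodize r (Set.Icc x y) ↔ ∃ k : ℤ, x + k * r ≤ t ∧ t ≤ y + k * r := by
  constructor
  · rintro ⟨s, ⟨h1, h2⟩, k, rfl⟩
    exact ⟨k, by linarith, by linarith⟩
  · rintro ⟨k, h1, h2⟩
    exact ⟨t - k * r, ⟨by linarith, by linarith⟩, k, by ring⟩

lemma add_int_mul_mem_periodize {r t : ℝ} {E : Set ℝ} (k : ℤ) :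
    t + k * r ∈ periodize r E ↔ t ∈ periodize r E := by
  constructor
  · rintro ⟨s, hs, j, h⟩
    exact ⟨s, hs, j - k, by push_cast; linarith⟩
  · rintro ⟨s, hs, j, h⟩
    exact ⟨s, hs, j + k, by push_cast; linarith⟩

lemma R_add_int_mul (a b c t : ℝ) (k : ℤ) : R a b c (t + k * a) = R a b c t + k * a := by
  unfold R blackHole
  rw [add_int_mul_mem_periodize, add_int_mul_mem_periodize]
  split_ifs <;> ring

lemma RTilde_add_int_mul (a b c t : ℝ) (k : ℤ) :
    RTilde a b c (t + k * a) = RTilde a b c t + k * a := by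
  unfold RTilde blackHoleTilde
  rw [add_int_mul_mem_periodize, add_int_mul_mem_periodize]
  split_ifs <;> ring

lemma iterate_add_int_mul {a : ℝ} {f : ℝ → ℝ} (hf : ∀ (t : ℝ) (k : ℤ), f (t + k * a) = f t + k * a)
    (n : ℕ) (t : ℝ) (k : ℤ) : f^[n] (t + k * a) = f^[n] t + k * a := by
  induction n with
  | zero => rfl
  | succ n ih => rw [Function.iterate_succ_apply', ih, hf, Function.iterate_succ_apply']

/-- No point of the invariant set lies in `(v - ε, v)`. -/
def LeftGap (a b c v ε : ℝ) : Prop := ∀ s ∈ invariantSet a b c, s < v → s ≤ v - ε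

/-- `v` is the first point of the invariant set in its period counted from `x + a ℤ`. -/
def IsFirst (a b c x v : ℝ) : Prop :=
  ∀ k : ℤ, x + k * a ≤ v → v < x + k * a + a → ∀ s ∈ invariantSet a b c, x + k * a ≤ s → v ≤ s

lemma LeftGap.add_int_mul {a b c v ε : ℝ} (h : LeftGap a b c v ε) (k : ℤ) :
    LeftGap a b c (v + k * a) ε := by
  intro s hs hlt
  have hs' := add_int_mul_mem (-k) hs
  push_cast at hs'
  have := h _ hs' (by linarith)
  linarith

lemma IsFirst.add_int_mul {a b c x v : ℝ} (h : IsFirst a b c x v) (k : ℤ) :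
    IsFirst a b c x (v + k * a) := by
  intro j h1 h2 s hs hle
  have hs' := add_int_mul_mem (-k) hs
  push_cast at hs'
  have := h (j - k) (by push_cast; linarith) (by push_cast; linarith) _ hs'
    (by push_cast; linarith)
  linarith

lemma IsFirst.exists_eq {a b c x v w : ℝ} (ha : 0 < a) (hv : IsFirst a b c x v)
    (hw : IsFirst a b c x w) (hvS : v ∈ invariantSet a b c) (hwS : w ∈ invariantSet a b c) :
    ∃ k : ℤ, v = w + k * a := by
  obtain ⟨k, hk1, hk2⟩ := exists_period ha v x
  obtain ⟨j, hj1, hj2⟩ := exists_period ha w x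
  refine ⟨k - j, ?_⟩
  have h1 := hv k hk1 hk2 _ (add_int_mul_mem (k - j) hwS) (by push_cast; linarith)
  have h2 := hw j hj1 hj2 _ (add_int_mul_mem (j - k) hvS) (by push_cast; linarith)
  push_cast at *
  linarith

/-- The monotone degree-one lift of `R`. -/
noncomputable def lift (a b c t : ℝ) : ℝ :=
  open Classical in
  R a b c t + if t ∈ periodize a (Set.Ico (cZero b c) a) then a else 0

lemma lift_eq (a b c t : ℝ) : ∃ k : ℤ, lift a b c t = R a b c t + k * a := by
  unfold lift
  split_ifs
  · exact ⟨1, by simp⟩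
  · exact ⟨0, by simp⟩

/-! ### Dynamics of `R` on the invariant set and transport of gaps -/

namespace Params

variable {a b c : ℝ}

lemma notMem_of_le_of_lt (p : Params a b c) {x y u v t : ℝ} {k : ℤ} (hyu : y ≤ u)
    (hva : v ≤ x + a) (h1 : u + k * a ≤ t) (h2 : t < v + k * a) :
    t ∉ periodize a (Set.Ico x y) := by
  rw [mem_periodize_Ico]
  rintro ⟨j, hj1, hj2⟩
  rcases lt_trichotomy j k with h | h | h
  · have := int_mul_add_le p.ha h
    by_cases hj : j = k
    · omega
    · have : (j : ℝ) * a ≤ k * a := by linarith [p.ha]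
      linarith
  · subst h; linarith
  · have := int_mul_add_le p.ha h
    linarith

lemma R_of_lt (_p : Params a b c) {t : ℝ} {k : ℤ} (h0 : k * a ≤ t)
    (h1 : t < k * a + (cZero b c + a - b)) : R a b c t = t + ⌊c / b⌋ * b + b := by
  unfold R
  rw [if_pos (mem_periodize_Ico.2 ⟨k, by linarith, by linarith⟩)]

lemma R_of_ge (p : Params a b c) {t : ℝ} {k : ℤ} (h0 : k * a + cZero b c ≤ t)
    (h1 : t < k * a + a) : R a b c t = t + ⌊c / b⌋ * b := by
  have := p.hab; have := p.lt_cZero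
  unfold R blackHole
  rw [if_neg (p.notMem_of_le_of_lt (u := cZero b c) (v := a) (k := k) _ _ _ _),
    if_neg (p.notMem_of_le_of_lt (u := cZero b c) (v := a) (k := k) _ _ _ _)] <;> linarith

lemma RTilde_of_lt (_p : Params a b c) {t : ℝ} {k : ℤ} (h0 : c - a + k * a ≤ t)
    (h1 : t < c - cZero b c + k * a) : RTilde a b c t = t - ⌊c / b⌋ * b := by
  unfold RTilde
  rw [if_pos (mem_periodize_Ico.2 ⟨k, by linarith, by linarith⟩)]

lemma RTilde_of_ge (p : Params a b c) {t : ℝ} {k : ℤ}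
    (h0 : c - cZero b c + (b - a) + k * a ≤ t) (h1 : t < c + k * a) :
    RTilde a b c t = t - ⌊c / b⌋ * b - b := by
  have := p.hab; have := p.lt_cZero; have := p.cZero_lt
  unfold RTilde blackHoleTilde
  rw [if_neg (p.notMem_of_le_of_lt (u := c - cZero b c + (b - a)) (v := c) (k := k) _ _ _ _),
    if_neg (p.notMem_of_le_of_lt (u := c - cZero b c + (b - a)) (v := c) (k := k) _ _ _ _)] <;>
  linarith

lemma R_mem (p : Params a b c) {t : ℝ} (ht : t ∈ invariantSet a b c) :
    R a b c t ∈ invariantSet a b c := by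
  obtain ⟨k, h0, h1⟩ := exists_period p.ha t 0
  rw [zero_add] at h0 h1
  rcases p.exists_succ ht h0 h1 with ⟨h, hm⟩ | ⟨h, hm⟩
  · rwa [p.R_of_lt h0 h]
  · rwa [p.R_of_ge h h1]

lemma iterate_R_mem (p : Params a b c) {t : ℝ} (ht : t ∈ invariantSet a b c) (n : ℕ) :
    (R a b c)^[n] t ∈ invariantSet a b c := by
  induction n with
  | zero => exact ht
  | succ n ih => rw [Function.iterate_succ_apply']; exact p.R_mem ih

lemma notMem_of_mem_blackHole (p : Params a b c) {t : ℝ} (h : t ∈ blackHole a b c) :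
    t ∉ invariantSet a b c := by
  intro ht
  have := p.lt_cZero; have := p.cZero_lt
  obtain ⟨k, h1, h2⟩ := mem_periodize_Ico.1 h
  rcases p.exists_succ (k := k) ht (by linarith) (by linarith) with ⟨h, -⟩ | ⟨h, -⟩ <;> linarith

lemma notMem_of_mem_blackHoleTilde (p : Params a b c) {t : ℝ} (h : t ∈ blackHoleTilde a b c) :
    t ∉ invariantSet a b c := by
  intro ht
  have := p.lt_cZero; have := p.cZero_lt
  obtain ⟨k, h1, h2⟩ := mem_periodize_Ico.1 h
  rcases p.exists_pred (k := k) ht (by linarith) (by linarith) with ⟨h, -⟩ | ⟨h, -⟩ <;> linarith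

lemma exists_R_eq (p : Params a b c) {t : ℝ} (ht : t ∈ invariantSet a b c) :
    ∃ s ∈ invariantSet a b c, R a b c s = t := by
  have hc := p.hc
  obtain ⟨k, h0, h1⟩ := exists_period p.ha t (c - a)
  rcases p.exists_pred ht h0 h1 with ⟨h, hm⟩ | ⟨h, hm⟩
  · refine ⟨_, hm, ?_⟩
    rw [p.R_of_ge (k := k - 1)]
    · ring
    · push_cast; linarith
    · push_cast; linarith
  · refine ⟨_, hm, ?_⟩
    rw [p.R_of_lt (k := k - 1)]
    · ring
    · push_cast; linarith
    · push_cast; linarith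

lemma RTilde_R (p : Params a b c) {t : ℝ} (ht : t ∉ blackHole a b c) :
    RTilde a b c (R a b c t) = t := by
  have hc := p.hc; have := p.lt_cZero; have := p.cZero_lt; have := p.hab
  obtain ⟨k, h0, h1⟩ := exists_period p.ha t 0
  rw [zero_add] at h0 h1
  by_cases h : t < k * a + (cZero b c + a - b)
  · rw [p.R_of_lt h0 h, p.RTilde_of_ge (k := k + 1)]
    · ring
    · push_cast; linarith
    · push_cast; linarith
  · have h' : k * a + cZero b c ≤ t := by
      by_contra! hlt
      exact ht (mem_periodize_Ico.2 ⟨k, by linarith, by linarith⟩)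
    rw [p.R_of_ge h' h1, p.RTilde_of_lt (k := k + 1)]
    · ring
    · push_cast; linarith
    · push_cast; linarith

lemma exists_R_eq_add (p : Params a b c) {t : ℝ} (ht : t ∈ invariantSet a b c) :
    ∃ k : ℕ, 0 < k ∧ R a b c t = t + k * b := by
  have hm : (⌊c / b⌋.toNat : ℤ) = ⌊c / b⌋ := Int.toNat_of_nonneg (by linarith [p.two_le])
  have hm' : ((⌊c / b⌋.toNat : ℕ) : ℝ) = ⌊c / b⌋ := by exact_mod_cast hm
  have := p.two_le
  obtain ⟨k, h0, h1⟩ := exists_period p.ha t 0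
  rw [zero_add] at h0 h1
  rcases p.exists_succ ht h0 h1 with ⟨h, -⟩ | ⟨h, -⟩
  · exact ⟨⌊c / b⌋.toNat + 1, by omega, by rw [p.R_of_lt h0 h]; push_cast; rw [hm']; ring⟩
  · exact ⟨⌊c / b⌋.toNat, by omega, by rw [p.R_of_ge h h1, hm']⟩

lemma exists_iterate_R_eq_add (p : Params a b c) {t : ℝ} (ht : t ∈ invariantSet a b c) (n : ℕ) :
    ∃ k : ℕ, n ≤ k ∧ (R a b c)^[n] t = t + k * b := by
  induction n with
  | zero => exact ⟨0, le_rfl, by simp⟩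
  | succ n ih =>
    obtain ⟨k, hk, h⟩ := ih
    obtain ⟨j, hj, h'⟩ := p.exists_R_eq_add (p.iterate_R_mem ht n)
    refine ⟨k + j, by omega, ?_⟩
    rw [Function.iterate_succ_apply', h', h]
    push_cast; ring

/-- By irrationality the orbits of points of the invariant set are infinite modulo `a`. -/
lemma eq_zero_of_iterate_R_eq (p : Params a b c) {t : ℝ} (ht : t ∈ invariantSet a b c) {n : ℕ}
    {k : ℤ} (h : (R a b c)^[n] t = t + k * a) : n = 0 := by
  obtain ⟨j, hj, h'⟩ := p.exists_iterate_R_eq_add ht n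
  by_contra hn
  have ha := p.ha; have hb := p.hb
  have h1 : (j : ℝ) * b = k * a := by linarith
  have hj0 : (0 : ℝ) < j := by exact_mod_cast (by omega : 0 < j)
  have hk0 : (k : ℝ) ≠ 0 := by
    intro hk
    rw [hk, zero_mul] at h1
    exact absurd h1 (by positivity)
  refine p.irr ⟨(j : ℚ) / k, ?_⟩
  push_cast
  rw [div_eq_div_iff hk0 hb.ne']
  linarith

lemma eq_of_iterate_R_eq (p : Params a b c) {t : ℝ} (ht : t ∈ invariantSet a b c) {n n' : ℕ}
    {k : ℤ} (h : (R a b c)^[n] t = (R a b c)^[n'] t + k * a) : n = n' := by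
  have key : ∀ {n n' : ℕ} {k : ℤ}, n ≤ n' →
      (R a b c)^[n'] t = (R a b c)^[n] t + k * a → n = n' := by
    intro n n' k hle h
    obtain ⟨i, rfl⟩ := Nat.exists_eq_add_of_le hle
    rw [add_comm n i, Function.iterate_add_apply] at h
    have := p.eq_zero_of_iterate_R_eq (p.iterate_R_mem ht n) h
    omega
  rcases le_total n n' with hle | hle
  · exact key (k := -k) hle (by push_cast; linarith)
  · exact (key hle h).symm

/-- In a period starting at c₀ the smaller displacement comes first and the points of the black hole
are absent; this makes the lift increasing within the period. -/
lemma lift_cases (p : Params a b c) {t : ℝ} (ht : t ∈ invariantSet a b c) {k : ℤ}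
    (h0 : cZero b c + k * a ≤ t) (h1 : t < cZero b c + k * a + a) :
    (t < k * a + a ∧ lift a b c t = t + ⌊c / b⌋ * b + a) ∨
      (k * a + a ≤ t ∧ t < k * a + a + (cZero b c + a - b) ∧
        lift a b c t = t + ⌊c / b⌋ * b + b) := by
  have := p.cZero_pos; have := p.cZero_lt; have := p.hab
  unfold lift
  by_cases h : t < k * a + a
  · left
    rw [if_pos (mem_periodize_Ico.2 ⟨k, h0, by linarith⟩), p.R_of_ge (k := k) (by linarith) h]
    exact ⟨h, rfl⟩
  · right
    push Not at h
    have h2 : t < k * a + a + (cZero b c + a - b) := by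
      by_contra! hle
      refine p.notMem_of_mem_blackHole (mem_periodize_Ico.2 ⟨k + 1, ?_, ?_⟩) ht
      · push_cast; linarith
      · push_cast; linarith
    rw [if_neg (p.notMem_of_le_of_lt (u := a) (v := cZero b c + a) (k := k) _ _ _ _),
      p.R_of_lt (k := k + 1), add_zero]
    · exact ⟨h, h2, rfl⟩
    all_goals first | linarith | (push_cast; linarith)

lemma lift_bounds (p : Params a b c) {t : ℝ} (ht : t ∈ invariantSet a b c) {k : ℤ}
    (h0 : cZero b c + k * a ≤ t) (h1 : t < cZero b c + k * a + a) :
    c + a + k * a ≤ lift a b c t ∧ lift a b c t < c + a + k * a + a := by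
  have hc := p.hc
  have := p.cZero_pos; have := p.cZero_lt; have := p.lt_cZero; have := p.hab
  rcases p.lift_cases ht h0 h1 with ⟨h, e⟩ | ⟨h, h', e⟩ <;> rw [e] <;> constructor <;> linarith

lemma lift_lt_lift (p : Params a b c) {s t : ℝ} (hs : s ∈ invariantSet a b c)
    (ht : t ∈ invariantSet a b c) (h : s < t) : lift a b c s < lift a b c t := by
  obtain ⟨j, hj0, hj1⟩ := exists_period p.ha s (cZero b c)
  obtain ⟨k, hk0, hk1⟩ := exists_period p.ha t (cZero b c)
  rcases lt_trichotomy j k with hjk | rfl | hjk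
  · have h1 := (p.lift_bounds hs hj0 hj1).2
    have h2 := (p.lift_bounds ht hk0 hk1).1
    have := int_mul_add_le p.ha hjk
    linarith
  · have := p.hab
    rcases p.lift_cases hs hj0 hj1 with ⟨h, e⟩ | ⟨h, h', e⟩ <;>
    rcases p.lift_cases ht hk0 hk1 with ⟨i, e'⟩ | ⟨i, i', e'⟩ <;> rw [e, e'] <;> linarith
  · have := int_mul_add_le p.ha hjk
    linarith

lemma lt_of_lift_lt_lift (p : Params a b c) {s t : ℝ} (hs : s ∈ invariantSet a b c)
    (ht : t ∈ invariantSet a b c) (h : lift a b c s < lift a b c t) : s < t := by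
  rcases lt_trichotomy s t with h' | rfl | h'
  · exact h'
  · exact absurd h (lt_irrefl _)
  · exact absurd h (p.lift_lt_lift ht hs h').not_gt

lemma lift_mem (p : Params a b c) {t : ℝ} (ht : t ∈ invariantSet a b c) :
    lift a b c t ∈ invariantSet a b c := by
  obtain ⟨k, h⟩ := lift_eq a b c t
  rw [h]
  exact add_int_mul_mem k (p.R_mem ht)

lemma exists_lift_eq (p : Params a b c) {t : ℝ} (ht : t ∈ invariantSet a b c) :
    ∃ s ∈ invariantSet a b c, lift a b c s = t := by
  obtain ⟨s, hs, rfl⟩ := p.exists_R_eq ht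
  obtain ⟨k, hk⟩ := lift_eq a b c s
  refine ⟨s + (-k : ℤ) * a, add_int_mul_mem _ hs, ?_⟩
  unfold lift at hk ⊢
  rw [R_add_int_mul]
  rw [add_int_mul_mem_periodize]
  push_cast
  linarith

lemma leftGap_lift_iff (_p : Params a b c) {t ε : ℝ} :
    LeftGap a b c (lift a b c t) ε ↔ LeftGap a b c (R a b c t) ε := by
  obtain ⟨k, hk⟩ := lift_eq a b c t
  rw [hk]
  refine ⟨fun h => ?_, fun h => h.add_int_mul k⟩
  have := h.add_int_mul (-k)
  push_cast at this
  rwa [show R a b c t + k * a + -(k : ℝ) * a = R a b c t by ring] at this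

lemma leftGap_R_of_forall (p : Params a b c) {v ε : ℝ} (hv : v ∈ invariantSet a b c)
    (h : ∀ s ∈ invariantSet a b c, s < v → lift a b c s ≤ lift a b c v - ε) :
    LeftGap a b c (R a b c v) ε := by
  rw [← p.leftGap_lift_iff]
  intro s' hs' hlt
  obtain ⟨s, hs, rfl⟩ := p.exists_lift_eq hs'
  exact h s hs (p.lt_of_lift_lt_lift hs hv hlt)

lemma lift_sub_bounds (p : Params a b c) {t : ℝ} (ht : t ∈ invariantSet a b c) :
    t + ⌊c / b⌋ * b + a ≤ lift a b c t ∧ lift a b c t ≤ t + ⌊c / b⌋ * b + b := by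
  have := p.hab
  obtain ⟨k, h0, h1⟩ := exists_period p.ha t (cZero b c)
  rcases p.lift_cases ht h0 h1 with ⟨h, e⟩ | ⟨h, h', e⟩ <;> rw [e] <;> constructor <;> linarith

/-- A gap shrinks at most by `b - a` under `R`. -/
lemma leftGap_R_of_add (p : Params a b c) {v ε : ℝ} (hv : v ∈ invariantSet a b c)
    (h : LeftGap a b c v (ε + (b - a))) : LeftGap a b c (R a b c v) ε := by
  refine p.leftGap_R_of_forall hv fun s hs hlt => ?_
  have := h s hs hlt
  have := p.lift_sub_bounds hs
  have := p.lift_sub_bounds hv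
  linarith

/-- A gap that does not contain the black hole does not shrink. -/
lemma leftGap_R (p : Params a b c) {v ε : ℝ} (hv : v ∈ invariantSet a b c)
    (h : LeftGap a b c v ε) (hf : ¬ IsFirst a b c (cZero b c) v) :
    LeftGap a b c (R a b c v) ε := by
  refine p.leftGap_R_of_forall hv ?_
  have hab := p.hab
  unfold IsFirst at hf
  push Not at hf
  obtain ⟨k, hk0, hk1, w, hw, hkw, hwv⟩ := hf
  -- Within the period starting at c₀ + k a the displacement does not decrease from s to v. Points
  -- before this period are compared with w instead, a point of S between its start and v.
  have key : ∀ s ∈ invariantSet a b c, cZero b c + k * a ≤ s → s < v →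
      lift a b c s ≤ lift a b c v - ε := by
    intro s hs hks hsv
    have := h s hs hsv
    rcases p.lift_cases hs hks (by linarith) with ⟨h, e⟩ | ⟨h, h', e⟩ <;>
    rcases p.lift_cases hv hk0 hk1 with ⟨i, e'⟩ | ⟨i, i', e'⟩ <;> rw [e, e'] <;> linarith
  intro s hs hsv
  rcases le_or_gt (cZero b c + k * a) s with hks | hks
  · exact key s hs hks hsv
  · exact (p.lift_lt_lift hs hw (hks.trans_le hkw)).le.trans (key w hw hkw hwv)

/-- A gap not meeting `a ℤ` does not grow. -/
lemma leftGap_of_R (p : Params a b c) {v ε : ℝ} (hv : v ∈ invariantSet a b c)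
    (h : LeftGap a b c (R a b c v) ε) (hf : ¬ IsFirst a b c 0 v) : LeftGap a b c v ε := by
  rw [← p.leftGap_lift_iff] at h
  have hab := p.hab; have := p.cZero_pos; have := p.cZero_lt; have := p.lt_cZero
  unfold IsFirst at hf
  push Not at hf
  obtain ⟨k, hk0, hk1, w, hw, hkw, hwv⟩ := hf
  -- Counted from aℤ, the order of the branches is reversed: the larger displacement comes first, so
  -- distances cannot grow within the period.
  have hform : ∀ t ∈ invariantSet a b c, 0 + k * a ≤ t → t < 0 + k * a + a →
      (t < cZero b c + k * a ∧ lift a b c t = t + ⌊c / b⌋ * b + b) ∨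
      (cZero b c + k * a ≤ t ∧ lift a b c t = t + ⌊c / b⌋ * b + a) := by
    intro t ht h0 h1
    rcases le_or_gt (cZero b c + k * a) t with hkt | hkt
    · right
      rcases p.lift_cases ht hkt (by linarith) with ⟨h, e⟩ | ⟨h, h', e⟩
      · exact ⟨hkt, e⟩
      · linarith
    · left
      rcases p.lift_cases (k := k - 1) ht (by push_cast; linarith) (by push_cast; linarith) with
        ⟨h, e⟩ | ⟨h, h', e⟩
      · push_cast at h; linarith
      · exact ⟨hkt, e⟩
  have key : ∀ s ∈ invariantSet a b c, 0 + k * a ≤ s → s < v → s ≤ v - ε := by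
    intro s hs hks hsv
    have := h _ (p.lift_mem hs) (p.lift_lt_lift hs hv hsv)
    rcases hform s hs hks (by linarith) with ⟨h, e⟩ | ⟨h, e⟩ <;>
    rcases hform v hv hk0 hk1 with ⟨i, e'⟩ | ⟨i, e'⟩ <;> rw [e, e'] at this <;> linarith
  intro s hs hsv
  rcases le_or_gt (0 + k * a) s with hks | hks
  · exact key s hs hks hsv
  · exact (hks.trans_le hkw).le.trans (key w hw hkw hwv)

/-- Only finitely many gaps modulo `a` have length at least `ε`. -/
lemma false_of_leftGap_seq (p : Params a b c) {ε : ℝ} (hε : 0 < ε) {w : ℕ → ℝ}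
    (hw : ∀ n, w n ∈ invariantSet a b c) (hgap : ∀ n, LeftGap a b c (w n) ε)
    (hinj : ∀ n n' (k : ℤ), w n = w n' + k * a → n = n') : False := by
  have ha := p.ha
  have hper : ∀ n, ∃ k : ℤ, 0 ≤ w n + k * a ∧ w n + k * a < a := by
    intro n
    obtain ⟨k, h0, h1⟩ := exists_period ha (w n) 0
    exact ⟨-k, by push_cast; linarith, by push_cast; linarith⟩
  choose κ h0 h1 using hper
  -- Pigeonhole over cells of length ε: two distinct representatives in one cell would violate the
  -- gap of the larger one.
  have hmaps : ∀ n, ⌊(w n + κ n * a) / ε⌋₊ ∈ Finset.range (⌊a / ε⌋₊ + 1) := by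
    intro n
    rw [Finset.mem_range, Nat.lt_succ_iff]
    exact Nat.floor_le_floor (by gcongr; exact (h1 n).le)
  obtain ⟨n, n', hne, heq⟩ := Finite.exists_ne_map_eq_of_infinite
    fun n => (⟨_, hmaps n⟩ : Finset.range (⌊a / ε⌋₊ + 1))
  have heq : ⌊(w n + κ n * a) / ε⌋₊ = ⌊(w n' + κ n' * a) / ε⌋₊ := congrArg Subtype.val heq
  have hlt : ∀ n n', ⌊(w n + κ n * a) / ε⌋₊ = ⌊(w n' + κ n' * a) / ε⌋₊ →
      ¬ w n + κ n * a < w n' + κ n' * a := by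
    intro n n' heq hlt
    have hg := ((hgap n').add_int_mul (κ n')) _ (add_int_mul_mem (κ n) (hw n)) hlt
    have e1 := Nat.floor_le (div_nonneg (h0 n) hε.le)
    have e2 := Nat.lt_floor_add_one ((w n' + κ n' * a) / ε)
    rw [← heq] at e2
    rw [le_div_iff₀ hε] at e1
    rw [div_lt_iff₀ hε] at e2
    linarith
  refine hne (hinj n n' (κ n' - κ n) ?_)
  have := le_antisymm (not_lt.1 (hlt n' n heq.symm)) (not_lt.1 (hlt n n' heq))
  push_cast
  linarith

lemma leftGap_iterate (p : Params a b c) {v ε : ℝ} (hv : v ∈ invariantSet a b c)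
    (h : LeftGap a b c v ε) (n : ℕ)
    (hn : ∀ i < n, ¬ IsFirst a b c (cZero b c) ((R a b c)^[i] v)) :
    LeftGap a b c ((R a b c)^[n] v) ε := by
  induction n with
  | zero => exact h
  | succ n ih =>
    rw [Function.iterate_succ_apply']
    exact p.leftGap_R (p.iterate_R_mem hv n) (ih fun i hi => hn i (by omega)) (hn n (by omega))

/-- The forward orbit of a gap runs into the black hole. -/
lemma exists_isFirst_iterate (p : Params a b c) {v ε : ℝ} (hε : 0 < ε)
    (hv : v ∈ invariantSet a b c) (h : LeftGap a b c v ε) :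
    ∃ n, IsFirst a b c (cZero b c) ((R a b c)^[n] v) := by
  by_contra! hne
  exact p.false_of_leftGap_seq hε (w := fun n => (R a b c)^[n] v) (p.iterate_R_mem hv)
    (fun n => p.leftGap_iterate hv h n fun i _ => hne i)
    (fun n n' k => p.eq_of_iterate_R_eq hv)

/-- The backward orbit of a gap comes from `a ℤ`. -/
lemma exists_isFirst_preimage (p : Params a b c) {v ε : ℝ} (hε : 0 < ε)
    (hv : v ∈ invariantSet a b c) (h : LeftGap a b c v ε) :
    ∃ n, ∃ w ∈ invariantSet a b c, (R a b c)^[n + 1] w = v ∧ IsFirst a b c 0 w := by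
  by_contra! hne
  have hpre : ∀ n, ∃ w ∈ invariantSet a b c, (R a b c)^[n] w = v ∧ LeftGap a b c w ε := by
    intro n
    induction n with
    | zero => exact ⟨v, hv, rfl, h⟩
    | succ n ih =>
      obtain ⟨w, hw, hwv, hgap⟩ := ih
      obtain ⟨u, hu, rfl⟩ := p.exists_R_eq hw
      rw [← Function.iterate_succ_apply] at hwv
      exact ⟨u, hu, hwv, p.leftGap_of_R hu hgap (hne n u hu hwv)⟩
  choose w hw hwv hgap using hpre
  refine p.false_of_leftGap_seq hε hw hgap fun n n' k hk => ?_
  -- The preimages for different n are chosen independently. If `w n` and `w n'` agree modulo `a`,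
  -- the orbit of `w n` meets v modulo `a` at both times n and n'.
  have e : (R a b c)^[n'] (w n) = v + k * a := by
    rw [hk, iterate_add_int_mul (R_add_int_mul a b c), hwv]
  have e' : (R a b c)^[n] (w n) = (R a b c)^[n'] (w n) + (-k : ℤ) * a := by
    rw [hwv, e]; push_cast; ring
  exact p.eq_of_iterate_R_eq (hw n) e'

/-- The gap would come, at least one step earlier, from the first point after 0, which is the same
point modulo `a`; orbits do not repeat. -/
lemma not_leftGap_of_isFirst_zero (p : Params a b c) {v ε : ℝ} (hε : 0 < ε)
    (hv : v ∈ invariantSet a b c) (h : IsFirst a b c 0 v) : ¬ LeftGap a b c v ε := by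
  intro hg
  obtain ⟨n, w, hw, rfl, hf⟩ := p.exists_isFirst_preimage hε hv hg
  obtain ⟨k, hk⟩ := h.exists_eq p.ha hf hv hw
  exact absurd (p.eq_zero_of_iterate_R_eq hw hk) (by omega)

/-- A gap left over after the black hole would be carried into the black hole again, forcing the
orbit to repeat. -/
lemma not_leftGap_R_of_isFirst (p : Params a b c) {v ε : ℝ} (hε : 0 < ε)
    (hv : v ∈ invariantSet a b c) (h : IsFirst a b c (cZero b c) v) :
    ¬ LeftGap a b c (R a b c v) ε := by
  intro hg
  obtain ⟨n, hf⟩ := p.exists_isFirst_iterate hε (p.R_mem hv) hg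
  rw [← Function.iterate_succ_apply] at hf
  obtain ⟨k, hk⟩ := hf.exists_eq p.ha h (p.iterate_R_mem hv _) hv
  exact absurd (p.eq_zero_of_iterate_R_eq hv hk) (by omega)

end Params
end AbcGabor

/-! ### Endpoints in the invariant set and the maximal gap length -/

namespace AbcGabor

lemma periodize_Ico_add_int_mul (a x d : ℝ) (k : ℤ) :
    periodize a (Set.Ico (x + k * a) (x + k * a + d)) = periodize a (Set.Ico x (x + d)) := by
  ext t
  rw [mem_periodize_Ico, mem_periodize_Ico]
  constructor
  · rintro ⟨j, h1, h2⟩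
    exact ⟨k + j, by push_cast; linarith, by push_cast; linarith⟩
  · rintro ⟨j, h1, h2⟩
    exact ⟨j - k, by push_cast; linarith, by push_cast; linarith⟩

lemma periodize_singleton_add_int_mul (a x : ℝ) (k : ℤ) :
    periodize a {x + k * a} = periodize a {x} := by
  ext t
  constructor
  · rintro ⟨_, rfl, j, rfl⟩
    exact ⟨x, rfl, k + j, by push_cast; ring⟩
  · rintro ⟨_, rfl, j, rfl⟩
    exact ⟨_, rfl, j - k, by push_cast; ring⟩

lemma image_periodize_Ico {a x y d : ℝ} {f : ℝ → ℝ}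
    (hf : ∀ (t : ℝ) (k : ℤ), f (t + k * a) = f t + k * a)
    (h : ∀ t, x ≤ t → t < x + d → f t = y + (t - x)) :
    f '' periodize a (Set.Ico x (x + d)) = periodize a (Set.Ico y (y + d)) := by
  ext t
  constructor
  · rintro ⟨_, ⟨s, ⟨h1, h2⟩, k, rfl⟩, rfl⟩
    refine ⟨f s, ?_, k, hf s k⟩
    rw [h s h1 h2]
    constructor <;> linarith
  · rintro ⟨s, ⟨h1, h2⟩, k, rfl⟩
    refine ⟨x + (s - y) + k * a, ⟨x + (s - y), ⟨by linarith, by linarith⟩, k, rfl⟩, ?_⟩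
    rw [hf, h _ (by linarith) (by linarith)]
    ring

namespace Params

variable {a b c : ℝ}

/-- Every point outside the invariant set lies in a gap whose right end is in the set. -/
lemma exists_leftGap_of_notMem (p : Params a b c) (hS : (invariantSet a b c).Nonempty) {x : ℝ}
    (hx : x ∉ invariantSet a b c) :
    ∃ v ∈ invariantSet a b c, x < v ∧ LeftGap a b c v (v - x) := by
  set T := invariantSet a b c ∩ Set.Ici x
  have hne : T.Nonempty := by
    obtain ⟨s, hs⟩ := hS
    obtain ⟨k, h0, h1⟩ := exists_period p.ha (x - s) 0
    exact ⟨s + (k + 1 : ℤ) * a, add_int_mul_mem _ hs, by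
      rw [Set.mem_Ici]; push_cast; linarith⟩
  have hbdd : BddBelow T := ⟨x, fun t ht => ht.2⟩
  have hmem : sInf T ∈ invariantSet a b c := by
    refine mem_invariantSet_of_forall_exists p.hb fun ε hε => ?_
    obtain ⟨s, hs, hlt⟩ := exists_lt_of_csInf_lt hne (lt_add_of_pos_right (sInf T) hε)
    exact ⟨s, hs.1, csInf_le hbdd hs, hlt⟩
  have hle : x ≤ sInf T := le_csInf hne fun t ht => ht.2
  refine ⟨sInf T, hmem, lt_of_le_of_ne hle fun h => hx (by rw [h]; exact hmem), fun s hs hlt => ?_⟩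
  by_contra! hxs
  have := csInf_le hbdd (show s ∈ T from ⟨hs, by rw [Set.mem_Ici]; linarith⟩)
  linarith

lemma isFirst_self (p : Params a b c) (x : ℝ) : IsFirst a b c x x := by
  have ha := p.ha
  intro k h0 h1 s _ hs
  obtain rfl : k = 0 := int_eq_of_mem_period (x := x) (t := x) p.ha h0 h1
    (by push_cast; linarith) (by push_cast; linarith)
  push_cast at hs
  linarith

lemma left_mem_blackHoleTilde (p : Params a b c) : c - cZero b c ∈ blackHoleTilde a b c :=
  mem_periodize_Ico.2 ⟨0, by simp, by push_cast; linarith [p.hab]⟩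

lemma zero_mem (p : Params a b c) (hS : (invariantSet a b c).Nonempty) :
    (0 : ℝ) ∈ invariantSet a b c := by
  obtain ⟨v, hv, hlt, hgap⟩ := p.exists_leftGap_of_notMem hS
    (p.notMem_of_mem_blackHoleTilde p.left_mem_blackHoleTilde)
  obtain ⟨n, w, hw, -, hf⟩ := p.exists_isFirst_preimage (sub_pos.2 hlt) hv hgap
  obtain ⟨k, h0, h1⟩ := exists_period p.ha w 0
  rcases h0.eq_or_lt with h | h
  · rwa [← h, add_int_mul_mem_iff] at hw
  · refine absurd ?_ (p.not_leftGap_of_isFirst_zero (sub_pos.2 h) hw hf)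
    intro s hs hsw
    by_contra! hlt
    have := hf k h0 h1 s hs (by linarith)
    linarith

lemma cZero_mem (p : Params a b c) (hS : (invariantSet a b c).Nonempty) :
    cZero b c ∈ invariantSet a b c := by
  obtain ⟨v, hv, hlt, hgap⟩ := p.exists_leftGap_of_notMem hS
    (p.notMem_of_mem_blackHoleTilde p.left_mem_blackHoleTilde)
  obtain ⟨n, hf⟩ := p.exists_isFirst_iterate (sub_pos.2 hlt) hv hgap
  have hw := p.iterate_R_mem hv n
  set w := (R a b c)^[n] v
  obtain ⟨k, h0, h1⟩ := exists_period p.ha w (cZero b c)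
  rcases h0.eq_or_lt with h | h
  · rwa [← h, add_int_mul_mem_iff] at hw
  -- If w lay strictly beyond c₀ + k a, its gap would contain the whole black hole and the excess,
  -- and the excess would survive under `R`.
  · refine absurd (p.leftGap_R_of_add hw ?_) (p.not_leftGap_R_of_isFirst (sub_pos.2 h) hw hf)
    intro s hs hsw
    by_contra! hlt
    rcases le_or_gt (cZero b c + k * a) s with hks | hks
    · have := hf k h0 h1 s hs hks
      linarith
    · exact p.notMem_of_mem_blackHole (mem_periodize_Ico.2 ⟨k, by linarith, by linarith⟩) hs

lemma R_zero (p : Params a b c) : R a b c 0 = ⌊c / b⌋ * b + b := by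
  have := p.lt_cZero
  rw [p.R_of_lt (k := 0)] <;> push_cast <;> linarith

/-- `R 0` is the right end of the black hole of `RTilde`, one period further on. -/
lemma leftGap_R_zero (p : Params a b c) : LeftGap a b c (R a b c 0) (b - a) := by
  have hc := p.hc
  rw [p.R_zero]
  intro s hs hlt
  by_contra! h
  refine p.notMem_of_mem_blackHoleTilde (mem_periodize_Ico.2 ⟨1, ?_, ?_⟩) hs
  · push_cast; linarith
  · push_cast; linarith

lemma exists_iterate_eq_cZero_of_leftGap (p : Params a b c)
    (hS : (invariantSet a b c).Nonempty) {v ε : ℝ} (hε : 0 < ε) (hv : v ∈ invariantSet a b c)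
    (h : LeftGap a b c v ε) : ∃ (n : ℕ) (k : ℤ), (R a b c)^[n] v = cZero b c + k * a := by
  obtain ⟨n, hf⟩ := p.exists_isFirst_iterate hε hv h
  exact ⟨n, hf.exists_eq p.ha (p.isFirst_self _) (p.iterate_R_mem hv n) (p.cZero_mem hS)⟩

lemma leftGap_iterate_of_eq_cZero (p : Params a b c) (hS : (invariantSet a b c).Nonempty)
    {v ε : ℝ} (hv : v ∈ invariantSet a b c) (h : LeftGap a b c v ε) {D : ℕ} {κ : ℤ}
    (hD : (R a b c)^[D] v = cZero b c + κ * a) {n : ℕ} (hn : n ≤ D) :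
    LeftGap a b c ((R a b c)^[n] v) ε := by
  -- The orbit meets c₀ modulo `a` at time D only, so the gap cannot shrink earlier.
  refine p.leftGap_iterate hv h n fun i hi hf => ?_
  obtain ⟨k, hk⟩ := hf.exists_eq p.ha (p.isFirst_self _) (p.iterate_R_mem hv i) (p.cZero_mem hS)
  have : (R a b c)^[i] v = (R a b c)^[D] v + (k - κ : ℤ) * a := by
    rw [hk, hD]; push_cast; ring
  have := p.eq_of_iterate_R_eq hv this
  omega

/-- All gaps have length at most `b - a`. -/
lemma le_of_leftGap (p : Params a b c) (hS : (invariantSet a b c).Nonempty) {v ε : ℝ}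
    (hv : v ∈ invariantSet a b c) (h : LeftGap a b c v ε) : ε ≤ b - a := by
  by_contra! hε
  obtain ⟨n, k, hk⟩ := p.exists_iterate_eq_cZero_of_leftGap hS (by linarith [p.hab]) hv h
  have h1 := p.leftGap_iterate_of_eq_cZero hS hv h hk le_rfl
  rw [hk] at h1
  have hm := add_int_mul_mem k (p.cZero_mem hS)
  refine p.not_leftGap_R_of_isFirst (sub_pos.2 hε) hm
    ((p.isFirst_self (cZero b c)).add_int_mul k) (p.leftGap_R_of_add hm ?_)
  rwa [sub_add_cancel]

/-- `R` translates a gap that contains no discontinuity. -/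
lemma R_eq_of_leftGap (p : Params a b c) (hS : (invariantSet a b c).Nonempty) {t x : ℝ}
    (ht : t ∈ invariantSet a b c) (h : LeftGap a b c t (b - a)) (h0 : ∀ k : ℤ, t ≠ k * a)
    (hf : ¬ IsFirst a b c (cZero b c) t) (hx : t - (b - a) ≤ x) (hxt : x ≤ t) :
    R a b c x = R a b c t + (x - t) := by
  have hlt := p.cZero_pos; have := p.cZero_lt; have := p.lt_cZero
  obtain ⟨k, hk0, hk1⟩ := exists_period p.ha t 0
  rw [zero_add] at hk0 hk1
  have hk : (k : ℝ) * a ≤ t - (b - a) := by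
    have hm := add_int_mul_mem k (p.zero_mem hS)
    rw [zero_add] at hm
    exact h _ hm (lt_of_le_of_ne hk0 (h0 k).symm)
  rcases p.exists_succ ht hk0 hk1 with ⟨h1, -⟩ | ⟨h1, -⟩
  · rw [p.R_of_lt hk0 h1, p.R_of_lt (k := k)] <;> linarith
  · have hx' : k * a + cZero b c ≤ x := by
      unfold IsFirst at hf
      push Not at hf
      obtain ⟨j, hj0, hj1, s, hs, hjs, hst⟩ := hf
      obtain rfl := int_eq_of_mem_period (k := k) p.ha hj0 hj1 (by linarith) (by linarith)
      have := h s hs hst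
      linarith
    rw [p.R_of_ge h1 hk1, p.R_of_ge hx'] <;> linarith

/-! ### The finite orbit of holes, described by their right ends, which lie in the invariant set -/

section Holes

/-! Throughout, `D` is the time after which the right end `R 0` of the black hole of `RTilde`
arrives at the right end `cZero` of the black hole of `R`. -/

variable {D : ℕ} {κ : ℤ}

lemma iterate_zero_ne (p : Params a b c) (hS : (invariantSet a b c).Nonempty) (n : ℕ) (k : ℤ) :
    (R a b c)^[n] (R a b c 0) ≠ k * a := by
  intro h
  rw [← Function.iterate_succ_apply] at h
  exact absurd (p.eq_zero_of_iterate_R_eq (p.zero_mem hS) (k := k) (by rw [h, zero_add]))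
    (by omega)

lemma leftGap_hole (p : Params a b c) (hS : (invariantSet a b c).Nonempty)
    (hD : (R a b c)^[D] (R a b c 0) = cZero b c + κ * a) {n : ℕ} (hn : n ≤ D) :
    LeftGap a b c ((R a b c)^[n] (R a b c 0)) (b - a) :=
  p.leftGap_iterate_of_eq_cZero hS (p.R_mem (p.zero_mem hS)) p.leftGap_R_zero hD hn

lemma R_eq_of_mem_hole (p : Params a b c) (hS : (invariantSet a b c).Nonempty)
    (hD : (R a b c)^[D] (R a b c 0) = cZero b c + κ * a) {n : ℕ} (hn : n < D) {x : ℝ}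
    (hx : (R a b c)^[n] (R a b c 0) - (b - a) ≤ x) (hx' : x ≤ (R a b c)^[n] (R a b c 0)) :
    R a b c x = (R a b c)^[n + 1] (R a b c 0) + (x - (R a b c)^[n] (R a b c 0)) := by
  have h0 := p.R_mem (p.zero_mem hS)
  rw [Function.iterate_succ_apply']
  refine p.R_eq_of_leftGap hS (p.iterate_R_mem h0 n) (p.leftGap_hole hS hD hn.le)
    (p.iterate_zero_ne hS n) (fun hf => ?_) hx hx'
  obtain ⟨k, hk⟩ := hf.exists_eq p.ha (p.isFirst_self _) (p.iterate_R_mem h0 n) (p.cZero_mem hS)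
  have : (R a b c)^[n] (R a b c 0) = (R a b c)^[D] (R a b c 0) + (k - κ : ℤ) * a := by
    rw [hk, hD]; push_cast; ring
  have := p.eq_of_iterate_R_eq h0 this
  omega

lemma iterate_left_eq (p : Params a b c) (hS : (invariantSet a b c).Nonempty)
    (hD : (R a b c)^[D] (R a b c 0) = cZero b c + κ * a) {n : ℕ} (hn : n ≤ D) :
    (R a b c)^[n] (c - cZero b c) = (R a b c)^[n] (R a b c 0) - (b - a) + (-1 : ℤ) * a := by
  induction n with
  | zero =>
    have hc := p.hc
    simp only [Function.iterate_zero, id, p.R_zero]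
    -- The shift by one period: c - c₀ = m b, while `R 0` = m b + b.
    push_cast; linarith
  | succ n ih =>
    have hab := p.hab
    rw [Function.iterate_succ_apply', ih (by omega), R_add_int_mul,
      p.R_eq_of_mem_hole hS hD (by omega) le_rfl (by linarith)]
    ring

/-- Backward from the black hole: `R` preserves S and carries the left end of each hole to the next
one. -/
lemma hole_left_notMem (p : Params a b c) (hS : (invariantSet a b c).Nonempty)
    (hD : (R a b c)^[D] (R a b c 0) = cZero b c + κ * a) {n : ℕ} (hn : n ≤ D) :
    (R a b c)^[n] (R a b c 0) - (b - a) ∉ invariantSet a b c := by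
  have hab := p.hab
  induction hn using Nat.decreasingInduction with
  | self =>
    rw [hD]
    exact p.notMem_of_mem_blackHole (mem_periodize_Ico.2 ⟨κ, by linarith, by linarith⟩)
  | of_succ n hn ih =>
    intro h
    have := p.R_mem h
    rw [p.R_eq_of_mem_hole hS hD hn le_rfl (by linarith)] at this
    exact ih (by convert this using 1; ring)

/-- If the right ends differed, the smaller, a point of S, would have to be the left end of the
other hole, which is not in S. Equal right ends force equal times. -/
lemma not_both_mem_hole (p : Params a b c) (hS : (invariantSet a b c).Nonempty)
    (hD : (R a b c)^[D] (R a b c 0) = cZero b c + κ * a) {n n' : ℕ} (hn : n ≤ D) (hn' : n' ≤ D)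
    (hne : n ≠ n') {x : ℝ} {k k' : ℤ}
    (h1 : (R a b c)^[n] (R a b c 0) - (b - a) + k * a ≤ x)
    (h2 : x ≤ (R a b c)^[n] (R a b c 0) + k * a)
    (h1' : (R a b c)^[n'] (R a b c 0) - (b - a) + k' * a ≤ x)
    (h2' : x ≤ (R a b c)^[n'] (R a b c 0) + k' * a) : False := by
  have h0 := p.R_mem (p.zero_mem hS)
  have hlt : ∀ {n n' : ℕ} {k k' : ℤ}, n' ≤ D →
      x ≤ (R a b c)^[n] (R a b c 0) + k * a →
      (R a b c)^[n'] (R a b c 0) - (b - a) + k' * a ≤ x →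
      ¬ (R a b c)^[n] (R a b c 0) + k * a < (R a b c)^[n'] (R a b c 0) + k' * a := by
    intro n n' k k' hn' h2 h1' hlt
    have hm := add_int_mul_mem k (p.iterate_R_mem h0 n)
    have := (p.leftGap_hole hS hD hn').add_int_mul k' _ hm hlt
    rw [show (R a b c)^[n] (R a b c 0) + k * a =
      (R a b c)^[n'] (R a b c 0) - (b - a) + k' * a by linarith, add_int_mul_mem_iff] at hm
    exact p.hole_left_notMem hS hD hn' hm
  have heq := le_antisymm (not_lt.1 (hlt hn h2' h1)) (not_lt.1 (hlt hn' h2 h1'))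
  exact hne (p.eq_of_iterate_R_eq h0 (k := k' - k) (by push_cast; linarith))

lemma notMem_of_mem_hole (p : Params a b c) (hS : (invariantSet a b c).Nonempty)
    (hD : (R a b c)^[D] (R a b c 0) = cZero b c + κ * a) {n : ℕ} (hn : n ≤ D) {x : ℝ} {k : ℤ}
    (h1 : (R a b c)^[n] (R a b c 0) - (b - a) + k * a ≤ x)
    (h2 : x < (R a b c)^[n] (R a b c 0) + k * a) : x ∉ invariantSet a b c := by
  intro hx
  have := (p.leftGap_hole hS hD hn).add_int_mul k x hx h2
  rw [show x = (R a b c)^[n] (R a b c 0) - (b - a) + k * a by linarith,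
    add_int_mul_mem_iff] at hx
  exact p.hole_left_notMem hS hD hn hx

lemma exists_mem_hole (p : Params a b c) (hS : (invariantSet a b c).Nonempty)
    (hD : (R a b c)^[D] (R a b c 0) = cZero b c + κ * a) {x : ℝ}
    (hx : x ∉ invariantSet a b c) :
    ∃ n ≤ D, ∃ k : ℤ, (R a b c)^[n] (R a b c 0) - (b - a) + k * a ≤ x ∧
      x < (R a b c)^[n] (R a b c 0) + k * a := by
  have h0 := p.R_mem (p.zero_mem hS)
  obtain ⟨v, hv, hlt, hgap⟩ := p.exists_leftGap_of_notMem hS hx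
  have hle := p.le_of_leftGap hS hv hgap
  obtain ⟨j, w, hw, hwv, hf⟩ := p.exists_isFirst_preimage (sub_pos.2 hlt) hv hgap
  obtain ⟨k, hk⟩ := hf.exists_eq p.ha (p.isFirst_self 0) hw (p.zero_mem hS)
  have hv' : v = (R a b c)^[j] (R a b c 0) + k * a := by
    rw [← hwv, hk, iterate_add_int_mul (R_add_int_mul a b c), Function.iterate_succ_apply]
  -- v is j steps after `R 0` and n steps before c₀, so n + j = D.
  obtain ⟨n, i, hn⟩ := p.exists_iterate_eq_cZero_of_leftGap hS (sub_pos.2 hlt) hv hgap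
  have : (R a b c)^[n + j] (R a b c 0) = (R a b c)^[D] (R a b c 0) + (i - k - κ : ℤ) * a := by
    rw [hv', iterate_add_int_mul (R_add_int_mul a b c), ← Function.iterate_add_apply] at hn
    rw [hD]; push_cast; linarith
  have := p.eq_of_iterate_R_eq h0 this
  exact ⟨j, by omega, k, by linarith, by linarith⟩

/-- The disjoint holes fit into one period. -/
lemma holes_le_floor (p : Params a b c) (hS : (invariantSet a b c).Nonempty)
    (hD : (R a b c)^[D] (R a b c 0) = cZero b c + κ * a) :
    (D : ℤ) ≤ ⌊a / (b - a)⌋ - 1 := by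
  have hd : 0 < b - a := sub_pos.2 p.hab
  have hper : ∀ n, ∃ k : ℤ, 0 ≤ (R a b c)^[n] (R a b c 0) + k * a ∧
      (R a b c)^[n] (R a b c 0) + k * a < a := by
    intro n
    obtain ⟨k, h0, h1⟩ := exists_period p.ha ((R a b c)^[n] (R a b c 0)) 0
    exact ⟨-k, by push_cast; linarith, by push_cast; linarith⟩
  choose k h0 h1 using hper
  set I : ℕ → Set ℝ := fun n => Set.Ico ((R a b c)^[n] (R a b c 0) - (b - a) + k n * a)
    ((R a b c)^[n] (R a b c 0) + k n * a) with hI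
  -- With right ends moved into [0, a), no hole can extend below 0, since 0 lies in S.
  have hsub : ⋃ n ∈ Finset.range (D + 1), I n ⊆ Set.Ico 0 a := by
    intro x hx
    simp only [Set.mem_iUnion, Finset.mem_range] at hx
    obtain ⟨n, hn, hx1, hx2⟩ := hx
    refine ⟨?_, hx2.trans (h1 n)⟩
    by_contra! hneg
    have h0n : (R a b c)^[n] (R a b c 0) + k n * a ≠ 0 := fun h =>
      p.iterate_zero_ne hS n (-k n) (by push_cast; linarith)
    exact p.notMem_of_mem_hole hS hD (by omega) (hx1.trans hneg.le)
      (lt_of_le_of_ne (h0 n) h0n.symm) (p.zero_mem hS)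
  have hdisj : (Finset.range (D + 1) : Set ℕ).PairwiseDisjoint I := by
    intro n hn n' hn' hne
    rw [Finset.mem_coe, Finset.mem_range] at hn hn'
    refine Set.disjoint_left.2 fun x hx hx' => ?_
    exact p.not_both_mem_hole hS hD (by omega) (by omega) hne hx.1 hx.2.le hx'.1 hx'.2.le
  have hvol := MeasureTheory.measure_mono (μ := MeasureTheory.volume) hsub
  rw [MeasureTheory.measure_biUnion_finset hdisj fun n _ => measurableSet_Ico] at hvol
  have hlen : ∀ n, MeasureTheory.volume (I n) = ENNReal.ofReal (b - a) := by
    intro n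
    rw [hI, Real.volume_Ico]
    congr 1
    ring
  simp only [hlen, Finset.sum_const, Finset.card_range, Real.volume_Ico, sub_zero] at hvol
  rw [← ENNReal.ofReal_nsmul, ENNReal.ofReal_le_ofReal_iff p.ha.le, nsmul_eq_mul] at hvol
  rw [le_sub_iff_add_le, Int.le_floor, le_div_iff₀ hd]
  push_cast at hvol ⊢
  exact hvol

end Holes

end Params

end AbcGabor

/-! ### Assembly of the main theorem -/

theorem mainTheorem8 (a b c : ℝ) (ha : 0 < a) (hab : a < b) (hbc : b < c)
    (hc₀ : b - a < AbcGabor.cZero b c) (hc₀' : AbcGabor.cZero b c < a)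
    (hfloor : 2 ≤ ⌊c / b⌋) (hirr : Irrational (a / b))
    (hS : (AbcGabor.invariantSet a b c).Nonempty) :
    ∃ D : ℕ, (D : ℤ) ≤ ⌊a / (b - a)⌋ - 1 ∧
      -- the orbits of the left endpoints of the two black holes are interchanged
      (∀ n ≤ D,
        AbcGabor.periodize a {(AbcGabor.RTilde a b c)^[n] (AbcGabor.cZero b c + a - b)} =
          AbcGabor.periodize a {(AbcGabor.R a b c)^[D - n] (c - AbcGabor.cZero b c)}) ∧
      -- the closed periodic holes are mutually disjoint
      (∀ n ≤ D, ∀ n' ≤ D, n ≠ n' →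
        AbcGabor.periodize a
            (Set.Icc ((AbcGabor.R a b c)^[n] (c - AbcGabor.cZero b c))
              ((AbcGabor.R a b c)^[n] (c - AbcGabor.cZero b c) + (b - a))) ∩
          AbcGabor.periodize a
            (Set.Icc ((AbcGabor.R a b c)^[n'] (c - AbcGabor.cZero b c))
              ((AbcGabor.R a b c)^[n'] (c - AbcGabor.cZero b c) + (b - a))) = ∅) ∧
      -- the images of the black holes are periodic holes of length `b - a`
      (∀ n ≤ D,
        (AbcGabor.R a b c)^[n] '' AbcGabor.blackHoleTilde a b c =
            AbcGabor.periodize a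
              (Set.Ico ((AbcGabor.R a b c)^[n] (c - AbcGabor.cZero b c))
                ((AbcGabor.R a b c)^[n] (c - AbcGabor.cZero b c) + (b - a))) ∧
        (AbcGabor.R a b c)^[n] '' AbcGabor.blackHoleTilde a b c =
            (AbcGabor.RTilde a b c)^[D - n] '' AbcGabor.blackHole a b c) ∧
      (AbcGabor.R a b c)^[D] '' AbcGabor.blackHoleTilde a b c = AbcGabor.blackHole a b c ∧
      -- the complement of `S` is the union of the holes
      (AbcGabor.invariantSet a b c)ᶜ =
        ⋃ n ∈ Set.Iic D, AbcGabor.periodize a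
          (Set.Ico ((AbcGabor.R a b c)^[n] (c - AbcGabor.cZero b c))
            ((AbcGabor.R a b c)^[n] (c - AbcGabor.cZero b c) + (b - a))) ∧
      (AbcGabor.invariantSet a b c)ᶜ =
        ⋃ n ∈ Set.Iic D, (AbcGabor.R a b c)^[n] '' AbcGabor.blackHoleTilde a b c ∧
      (AbcGabor.invariantSet a b c)ᶜ =
        ⋃ n ∈ Set.Iic D, (AbcGabor.RTilde a b c)^[n] '' AbcGabor.blackHole a b c ∧
      (AbcGabor.invariantSet a b c)ᶜ =
        ⋃ n ∈ Set.Iic D, AbcGabor.periodize a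
          (Set.Ico ((AbcGabor.RTilde a b c)^[n] (AbcGabor.cZero b c + a - b))
            ((AbcGabor.RTilde a b c)^[n] (AbcGabor.cZero b c + a - b) + (b - a))) := by
  have p : AbcGabor.Params a b c := ⟨ha, hab, hbc, hc₀, hc₀', hfloor, hirr⟩
  have h0 := p.R_mem (p.zero_mem hS)
  obtain ⟨D, κ, hD⟩ := p.exists_iterate_eq_cZero_of_leftGap hS (sub_pos.2 hab) h0 p.leftGap_R_zero
  have hhole : ∀ n ≤ D, ∀ x, x ∈ AbcGabor.periodize a
      (Set.Ico ((AbcGabor.R a b c)^[n] (c - AbcGabor.cZero b c))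
        ((AbcGabor.R a b c)^[n] (c - AbcGabor.cZero b c) + (b - a))) ↔
      ∃ k : ℤ, (AbcGabor.R a b c)^[n] (AbcGabor.R a b c 0) - (b - a) + k * a ≤ x ∧
        x < (AbcGabor.R a b c)^[n] (AbcGabor.R a b c 0) + k * a := by
    intro n hn x
    rw [p.iterate_left_eq hS hD hn, AbcGabor.periodize_Ico_add_int_mul, sub_add_cancel,
      AbcGabor.mem_periodize_Ico]
  have hdisj : ∀ n ≤ D, ∀ n' ≤ D, n ≠ n' →
      AbcGabor.periodize a (Set.Icc ((AbcGabor.R a b c)^[n] (c - AbcGabor.cZero b c))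
        ((AbcGabor.R a b c)^[n] (c - AbcGabor.cZero b c) + (b - a))) ∩
      AbcGabor.periodize a (Set.Icc ((AbcGabor.R a b c)^[n'] (c - AbcGabor.cZero b c))
        ((AbcGabor.R a b c)^[n'] (c - AbcGabor.cZero b c) + (b - a))) = ∅ := by
    intro n hn n' hn' hne
    refine Set.eq_empty_of_forall_notMem fun x hx => ?_
    obtain ⟨k, h1, h2⟩ := AbcGabor.mem_periodize_Icc.1 hx.1
    obtain ⟨k', h1', h2'⟩ := AbcGabor.mem_periodize_Icc.1 hx.2
    rw [p.iterate_left_eq hS hD hn] at h1 h2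
    rw [p.iterate_left_eq hS hD hn'] at h1' h2'
    refine p.not_both_mem_hole hS hD hn hn' hne (x := x) (k := k - 1) (k' := k' - 1) ?_ ?_ ?_ ?_ <;>
    push_cast at * <;> linarith
  have hlast : (AbcGabor.R a b c)^[D] (c - AbcGabor.cZero b c) =
      AbcGabor.cZero b c + a - b + (κ - 1 : ℤ) * a := by
    rw [p.iterate_left_eq hS hD le_rfl, hD]; push_cast; ring
  set hole : ℕ → Set ℝ := fun n => AbcGabor.periodize a
    (Set.Ico ((AbcGabor.R a b c)^[n] (c - AbcGabor.cZero b c))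
      ((AbcGabor.R a b c)^[n] (c - AbcGabor.cZero b c) + (b - a))) with hole_def
  have hole_zero : hole 0 = AbcGabor.blackHoleTilde a b c := by
    rw [hole_def, AbcGabor.blackHoleTilde]
    simp only [Function.iterate_zero, id, add_sub_assoc]
  have hole_last : hole D = AbcGabor.blackHole a b c := by
    simp only [hole_def]
    rw [hlast, AbcGabor.periodize_Ico_add_int_mul, AbcGabor.blackHole]
    congr 2
    ring
  -- Holes before the last miss the black hole of `R`, so `RTilde` inverts `R` on them and retraces
  -- the orbit backward.
  have hnotMem : ∀ n < D, ∀ x ∈ hole n, x ∉ AbcGabor.blackHole a b c := by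
    intro n hn x hx hx'
    rw [← hole_last] at hx'
    obtain ⟨k, h1, h2⟩ := (hhole n hn.le x).1 hx
    obtain ⟨k', h1', h2'⟩ := (hhole D le_rfl x).1 hx'
    exact p.not_both_mem_hole hS hD hn.le le_rfl hn.ne h1 h2.le h1' h2'.le
  have hstep : ∀ n < D, AbcGabor.R a b c '' hole n = hole (n + 1) := by
    intro n hn
    refine AbcGabor.image_periodize_Ico (AbcGabor.R_add_int_mul a b c) fun t h1 h2 => ?_
    rw [p.iterate_left_eq hS hD hn.le] at h1 h2 ⊢
    rw [p.iterate_left_eq hS hD hn]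
    have := p.R_eq_of_mem_hole hS hD hn (x := t + (1 : ℤ) * a) (by push_cast at *; linarith)
      (by push_cast at *; linarith)
    rw [AbcGabor.R_add_int_mul] at this
    push_cast at *
    linarith
  have hstepTilde : ∀ n < D, AbcGabor.RTilde a b c '' hole (n + 1) = hole n := by
    intro n hn
    rw [← hstep n hn, Set.image_image]
    refine (Set.image_congr fun x hx => p.RTilde_R (hnotMem n hn x hx)).trans ?_
    exact Set.image_id' _
  have hR : ∀ n ≤ D, (AbcGabor.R a b c)^[n] '' AbcGabor.blackHoleTilde a b c = hole n := by
    intro n hn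
    induction n with
    | zero => rw [hole_zero, Function.iterate_zero, Set.image_id]
    | succ n ih =>
      rw [Function.iterate_succ', Set.image_comp, ih (by omega), hstep n (by omega)]
  have hRT : ∀ n ≤ D, (AbcGabor.RTilde a b c)^[n] '' AbcGabor.blackHole a b c = hole (D - n) := by
    intro n hn
    induction n with
    | zero => rw [Nat.sub_zero, hole_last, Function.iterate_zero, Set.image_id]
    | succ n ih =>
      rw [Function.iterate_succ', Set.image_comp, ih (by omega),
        show D - n = D - (n + 1) + 1 by omega, hstepTilde _ (by omega)]
  have hleft : ∀ n ≤ D, (AbcGabor.RTilde a b c)^[n] (AbcGabor.cZero b c + a - b) =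
      (AbcGabor.R a b c)^[D - n] (c - AbcGabor.cZero b c) + (1 - κ : ℤ) * a := by
    intro n hn
    induction n with
    | zero =>
      rw [Nat.sub_zero, hlast, Function.iterate_zero, id]
      push_cast; ring
    | succ n ih =>
      rw [Function.iterate_succ_apply', ih (by omega), AbcGabor.RTilde_add_int_mul,
        show D - n = D - (n + 1) + 1 by omega, Function.iterate_succ_apply', p.RTilde_R]
      refine hnotMem (D - (n + 1)) (by omega) _
        (AbcGabor.mem_periodize_Ico.2 ⟨0, by simp, by push_cast; linarith⟩)
  have hcompl : (AbcGabor.invariantSet a b c)ᶜ = ⋃ n ∈ Set.Iic D, hole n := by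
    ext x
    simp only [Set.mem_compl_iff, Set.mem_iUnion, Set.mem_Iic, exists_prop]
    constructor
    · intro hx
      obtain ⟨n, hn, h⟩ := p.exists_mem_hole hS hD hx
      exact ⟨n, hn, (hhole n hn x).2 h⟩
    · rintro ⟨n, hn, h⟩
      obtain ⟨k, h1, h2⟩ := (hhole n hn x).1 h
      exact p.notMem_of_mem_hole hS hD hn h1 h2
  have hflip : ⋃ n ∈ Set.Iic D, hole (D - n) = ⋃ n ∈ Set.Iic D, hole n := by
    ext x
    simp only [Set.mem_iUnion, Set.mem_Iic, exists_prop]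
    constructor
    · rintro ⟨n, hn, h⟩
      exact ⟨D - n, by omega, h⟩
    · rintro ⟨n, hn, h⟩
      exact ⟨D - n, by omega, by rwa [Nat.sub_sub_self hn]⟩
  refine ⟨D, p.holes_le_floor hS hD, fun n hn => ?_, hdisj, fun n hn => ⟨hR n hn, ?_⟩, ?_, hcompl,
    ?_, ?_, ?_⟩
  · rw [hleft n hn, AbcGabor.periodize_singleton_add_int_mul]
  · rw [hR n hn, hRT _ (by omega), Nat.sub_sub_self hn]
  · rw [hR D le_rfl, hole_last]
  · rw [hcompl]
    exact (Set.iUnion₂_congr fun n hn => hR n hn).symm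
  · rw [hcompl, ← hflip]
    exact (Set.iUnion₂_congr fun n hn => hRT n hn).symm
  · rw [hcompl, ← hflip]
    refine Set.iUnion₂_congr fun n hn => ?_
    rw [hleft n hn, AbcGabor.periodize_Ico_add_int_mul]
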